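/- Let $\Bbbk$ be a field. For a finite set $J$, a \emph{word} on $J$ is a total ordering of $J$, a \emph{path} on $J$ is a word on $J$ up to reversal, and a \emph{set of paths} on $J$ is a partition of $J$ together with a path on each part. Let $F[J]$ be the $\Bbbk$-vector space with basis the sets of paths on $J$ (so $F[\emptyset]=\Bbbk$). For $J=S\sqcup T$ let $\Delta_{S,T}:F[J]\to F[S]\otimes F[T]$, $\alpha\mapsto\alpha_{|S}\otimes\alpha_{/S}$, where $\alpha_{|S}$ is obtained from $\alpha$ by erasing all letters not in $S$ (and forgetting empty parts), and $\alpha_{/S}$ by replacing each letter in $S$ by a separation symbol $|$ (again forgetting empty parts). Let $\Delta_{S_1,\dots,S_n}$ be the iterated coproducts, and let $\zeta_J:F[J]\to\Bbbk$ be the linear map sending a set of paths to $1$ if all its paths have exactly one element and to $0$ otherwise. For a finite set $I$, $x\in F[I]$ and $n\in\mathbb N$ put $$\chi^F_I(x)(n)=\sum_{(S_1,\dots,S_n)}\bigl(\zeta_{S_1}\otimes\dots\otimes\zeta_{S_n}\bigr)\bigl(\Delta_{S_1,\dots,S_n}(x)\bigr),$$ the sum being over all sequences of $n$ pairwise disjoint,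 possibly empty, subsets with union $I$ (the basic invariant of the Hopf monoid $F$ of sets of paths). Let $I$ be a finite set and let $\alpha$ be a path on $I$; fix one of the (at most two) total orderings $w$ of $I$ that represent $\alpha$. Given a binary tree $t$ with $|I|$ vertices (left and right children are distinguished), identify its vertices, read from left to right (in-order), with the elements of $I$ in the order $w$. A coloring $c:I\to[n]=\{1,\dots,n\}$ is \emph{compatible} with $t$ if $c(u)\le c(v)$ whenever $u$ is a child of $v$ in $t$, and \emph{strictly compatible} with $t$ if $c(u)<c(v)$ whenever $u$ is a child of $v$ in $t$. Then: 1. For every $n\in\mathbb N$, $\chi^F_I(\alpha)(n)$ is (the image in $\Bbbk$ of) the number of strictly compatible pairs consisting of a binary tree with $|I|$ vertices and a coloring $I\to[n]$. 2. If $\Bbbk$ has characteristic $0$, there is a unique polynomial over $\Bbbk$, again denoted $\chi^F_I(\alpha)$, that takes the value $\chi^F_I(\alpha)(n)$ at every $n\in\mathbb N$; and for every $n\in\mathbb N$, $(-1)^{|I|}\chi^F_I(\alpha)(-n)$ is the number of compatible pairs consisting of a binary tree with $|I|$ vertices and a coloring $I\to[n]$. In particular $$(-1)^{|I|}\chi^F_I(\alpha)(-1)=C_{|I|},$$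 where $C_m=\frac1{m+1}\binom{2m}{m}$ is the $m$-th Catalan number. -/

import Mathlib

open scoped TensorProduct

noncomputable section

namespace PathMonoid

/-! ### Words up to reversal -/

/-- Two words are identified when they are equal or reverse to one another. -/
def revSetoid (V : Type*) : Setoid (List V) where
  r w w' := w' = w ∨ w' = w.reverse
  iseqv := by
    refine ⟨fun w => Or.inl rfl, ?_, ?_⟩
    · rintro x y (rfl | rfl) <;> simp
    · rintro x y z (rfl | rfl) (rfl | rfl) <;> simp

/-- Words with letters in `V`, up to reversal. -/
def UWord (V : Type*) : Type _ := Quotient (revSetoid V)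

namespace UWord

/-- The class of a word. -/
def mk {V : Type*} (w : List V) : UWord V := Quotient.mk (revSetoid V) w

theorem mk_eq_mk {V : Type*} {w w' : List V} :
    mk w = mk w' ↔ w' = w ∨ w' = w.reverse :=
  Quotient.eq (r := revSetoid V)

theorem exists_rep {V : Type*} (p : UWord V) : ∃ w, mk w = p :=
  Quotient.exists_rep p

/-- No letter is repeated. -/
def Nodup {V : Type*} (p : UWord V) : Prop :=
  Quotient.liftOn p List.Nodup (by
    rintro a b (rfl | rfl) <;> simp)

@[simp] theorem nodup_mk {V : Type*} (w : List V) : (mk w).Nodup ↔ w.Nodup := Iff.rfl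

/-- The set of letters. -/
def support {V : Type*} [DecidableEq V] (p : UWord V) : Finset V :=
  Quotient.liftOn p List.toFinset (by
    rintro a b (rfl | rfl) <;> simp)

@[simp] theorem support_mk {V : Type*} [DecidableEq V] (w : List V) :
    (mk w).support = w.toFinset := rfl

/-- `p ∩ S`: erase the letters that are not in `S`. -/
def restrict {V : Type*} [DecidableEq V] (S : Finset V) (p : UWord V) : UWord V :=
  Quotient.liftOn p (fun w => mk (w.filter (fun v => decide (v ∈ S)))) (by
    rintro a b (rfl | rfl)
    · rfl
    · exact mk_eq_mk.2 (Or.inr (by simp)))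

@[simp] theorem restrict_mk {V : Type*} [DecidableEq V] (S : Finset V) (w : List V) :
    (mk w).restrict S = mk (w.filter (fun v => decide (v ∈ S))) := rfl

theorem support_restrict {V : Type*} [DecidableEq V] (S : Finset V) (p : UWord V) :
    (p.restrict S).support = p.support ∩ S := by
  obtain ⟨w, rfl⟩ := p.exists_rep
  ext v
  simp

/-- `q` is one of the (possibly empty) words into which `p` falls apart when every letter that
lies in `S` is replaced by a separation symbol. -/
def IsPiece {V : Type*} [DecidableEq V] (S : Finset V) (p q : UWord V) : Prop :=
  ∃ w s : List V, mk w = p ∧ s ∈ w.splitOnP (fun v => decide (v ∈ S)) ∧ mk s = q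

end UWord

theorem splitOnP_reverse {V : Type*} (f : V → Bool) (w : List V) :
    w.reverse.splitOnP f = ((w.splitOnP f).map List.reverse).reverse := by
  induction h : w.length using Nat.strong_induction_on generalizing w with
  | _ n ih =>
    by_cases hw : ∀ x ∈ w, f x = false
    · rw [List.splitOnP_eq_singleton hw, List.splitOnP_eq_singleton (by simpa using hw)]
      simp
    · push Not at hw
      obtain ⟨a, ha, hfa⟩ := hw
      obtain ⟨x, y, rfl⟩ := List.append_of_mem ha
      have hfa' : f a = true := by simpa using hfa
      have e : (x ++ a :: y).reverse = y.reverse ++ a :: x.reverse := by simp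
      simp only [List.length_append, List.length_cons] at h
      rw [e, List.splitOnP_append_cons _ _ hfa', List.splitOnP_append_cons _ _ hfa',
        ih x.length (by omega) x rfl, ih y.length (by omega) y rfl]
      simp

theorem flatten_splitOnP {V : Type*} (f : V → Bool) (w : List V) :
    (w.splitOnP f).flatten = w.filter (fun v => !f v) := by
  induction h : w.length using Nat.strong_induction_on generalizing w with
  | _ n ih =>
    by_cases hw : ∀ x ∈ w, f x = false
    · rw [List.splitOnP_eq_singleton hw]
      simp only [List.flatten_cons, List.flatten_nil, List.append_nil]
      exact (List.filter_eq_self.2 (by simpa using hw)).symm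
    · push Not at hw
      obtain ⟨a, ha, hfa⟩ := hw
      obtain ⟨x, y, rfl⟩ := List.append_of_mem ha
      have hfa' : f a = true := by simpa using hfa
      simp only [List.length_append, List.length_cons] at h
      rw [List.splitOnP_append_cons _ _ hfa', List.flatten_append,
        ih x.length (by omega) x rfl, ih y.length (by omega) y rfl]
      simp [hfa']

namespace UWord

theorem isPiece_mk {V : Type*} [DecidableEq V] (S : Finset V) (w : List V) (q : UWord V) :
    IsPiece S (mk w) q ↔ ∃ s ∈ w.splitOnP (fun v => decide (v ∈ S)), mk s = q := by
  constructor
  · rintro ⟨w', s, hw, hs, rfl⟩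
    rcases mk_eq_mk.1 hw with rfl | rfl
    · exact ⟨s, hs, rfl⟩
    · refine ⟨s.reverse, ?_, mk_eq_mk.2 (Or.inr (by simp))⟩
      rw [splitOnP_reverse]
      simpa using hs
  · rintro ⟨s, hs, rfl⟩
    exact ⟨w, s, rfl, hs, rfl⟩

theorem exists_isPiece {V : Type*} [DecidableEq V] {S : Finset V} {p : UWord V} {v : V} :
    (∃ q, IsPiece S p q ∧ v ∈ q.support) ↔ v ∈ p.support ∧ v ∉ S := by
  obtain ⟨w, rfl⟩ := p.exists_rep
  have h := congrArg (v ∈ ·) (flatten_splitOnP (fun v => decide (v ∈ S)) w)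
  simp only [List.mem_flatten, List.mem_filter, eq_iff_iff] at h
  simp only [isPiece_mk, support_mk, List.mem_toFinset]
  constructor
  · rintro ⟨_, ⟨s, hs, rfl⟩, hv⟩
    simpa using h.1 ⟨s, hs, by simpa using hv⟩
  · intro hv
    obtain ⟨s, hs, hvs⟩ := h.2 (by simpa using hv)
    exact ⟨mk s, ⟨s, hs, rfl⟩, by simpa using hvs⟩

theorem IsPiece.nodup {V : Type*} [DecidableEq V] {S : Finset V} {p q : UWord V}
    (h : IsPiece S p q) (hp : p.Nodup) : q.Nodup := by
  obtain ⟨w, rfl⟩ := p.exists_rep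
  obtain ⟨s, hs, rfl⟩ := (isPiece_mk S w q).1 h
  have hn : ((w.splitOnP (fun v => decide (v ∈ S))).flatten).Nodup := by
    rw [flatten_splitOnP]
    exact List.Nodup.filter _ hp
  exact (List.nodup_flatten.1 hn).1 s hs

theorem IsPiece.eq_of_mem {V : Type*} [DecidableEq V] {S : Finset V} {p q q' : UWord V} {v : V}
    (hp : p.Nodup) (h : IsPiece S p q) (h' : IsPiece S p q')
    (hv : v ∈ q.support) (hv' : v ∈ q'.support) : q = q' := by
  obtain ⟨w, rfl⟩ := p.exists_rep
  obtain ⟨s, hs, rfl⟩ := (isPiece_mk S w q).1 h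
  obtain ⟨s', hs', rfl⟩ := (isPiece_mk S w q').1 h'
  have hn : ((w.splitOnP (fun v => decide (v ∈ S))).flatten).Nodup := by
    rw [flatten_splitOnP]
    exact List.Nodup.filter _ hp
  by_contra hne
  have hss : s ≠ s' := fun e => hne (by rw [e])
  have : Std.Symm (List.Disjoint (α := V)) := ⟨fun _ _ h => h.symm⟩
  exact (List.nodup_flatten.1 hn).2.forall hs hs' hss (by simpa using hv) (by simpa using hv')

end UWord

/-! ### The species of sets of paths -/

/-- A set of paths on the finite set `I`: a partition of `I` together with, on each part, a word
using every element of the part exactly once, taken up to reversal. It is recorded as the set of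
these paths. -/
@[ext]
structure SetOfPaths {V : Type*} [DecidableEq V] (I : Finset V) where
  /-- The paths. -/
  paths : Set (UWord V)
  nodup : ∀ p ∈ paths, p.Nodup
  nonempty : ∀ p ∈ paths, p.support.Nonempty
  disjoint : ∀ p ∈ paths, ∀ q ∈ paths, p ≠ q → Disjoint p.support q.support
  cover : ∀ v, v ∈ I ↔ ∃ p ∈ paths, v ∈ p.support

namespace SetOfPaths

/-- The restriction `α_{|S} = s₁ ∩ S | ⋯ | s_l ∩ S`, forgetting the empty parts. -/
def restrict {V : Type*} [DecidableEq V] {I : Finset V} (α : SetOfPaths I) (S : Finset V)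
    (hS : S ⊆ I) : SetOfPaths S where
  paths := {q | q.support.Nonempty ∧ ∃ p ∈ α.paths, q = p.restrict S}
  nodup := by
    rintro q ⟨-, p, hp, rfl⟩
    obtain ⟨w, rfl⟩ := p.exists_rep
    exact List.Nodup.filter _ (α.nodup _ hp)
  nonempty := fun q hq => hq.1
  disjoint := by
    rintro q ⟨-, p, hp, rfl⟩ q' ⟨-, p', hp', rfl⟩ hne
    rw [UWord.support_restrict, UWord.support_restrict]
    exact (α.disjoint p hp p' hp' (fun e => hne (by rw [e]))).mono
      Finset.inter_subset_left Finset.inter_subset_left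
  cover := by
    intro v
    constructor
    · intro hv
      obtain ⟨p, hp, hvp⟩ := (α.cover v).1 (hS hv)
      have hm : v ∈ (p.restrict S).support := by
        rw [UWord.support_restrict]; exact Finset.mem_inter.2 ⟨hvp, hv⟩
      exact ⟨_, ⟨⟨v, hm⟩, p, hp, rfl⟩, hm⟩
    · rintro ⟨q, ⟨-, p, hp, rfl⟩, hv⟩
      rw [UWord.support_restrict] at hv
      exact (Finset.mem_inter.1 hv).2

/-- The contraction `α_{/S}`: each occurrence of an element of `S` in `α` is replaced by the
separation symbol. Its ground set is the complement `T` of `S`. -/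
def contract {V : Type*} [DecidableEq V] {I : Finset V} (α : SetOfPaths I) (S T : Finset V)
    (hST : S ∪ T = I) (hd : Disjoint S T) : SetOfPaths T where
  paths := {q | q.support.Nonempty ∧ ∃ p ∈ α.paths, UWord.IsPiece S p q}
  nodup := by
    rintro q ⟨-, p, hp, h⟩
    exact h.nodup (α.nodup p hp)
  nonempty := fun q hq => hq.1
  disjoint := by
    rintro q ⟨-, p, hp, h⟩ q' ⟨-, p', hp', h'⟩ hne
    rw [Finset.disjoint_left]
    intro v hv hv'
    have h1 := (UWord.exists_isPiece.1 ⟨q, h, hv⟩).1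
    have h2 := (UWord.exists_isPiece.1 ⟨q', h', hv'⟩).1
    have e : p = p' := by
      by_contra hpp
      exact Finset.disjoint_left.1 (α.disjoint p hp p' hp' hpp) h1 h2
    subst e
    exact hne (UWord.IsPiece.eq_of_mem (α.nodup p hp) h h' hv hv')
  cover := by
    intro v
    constructor
    · intro hv
      obtain ⟨p, hp, hvp⟩ := (α.cover v).1 (hST ▸ Finset.mem_union_right S hv)
      obtain ⟨q, hq, hvq⟩ := UWord.exists_isPiece.2
        ⟨hvp, fun hvS => Finset.disjoint_left.1 hd hvS hv⟩
      exact ⟨q, ⟨⟨v, hvq⟩, p, hp, hq⟩, hvq⟩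
    · rintro ⟨q, ⟨-, p, hp, h⟩, hv⟩
      obtain ⟨h1, h2⟩ := UWord.exists_isPiece.1 ⟨q, h, hv⟩
      have h3 : v ∈ S ∪ T := hST ▸ (α.cover v).2 ⟨p, hp, h1⟩
      exact (Finset.mem_union.1 h3).resolve_left h2

/-- A set of paths is discrete when all its paths have only one element. -/
def IsDiscrete {V : Type*} [DecidableEq V] {I : Finset V} (α : SetOfPaths I) : Prop :=
  ∀ p ∈ α.paths, ∃ v, p = UWord.mk [v]

/-- The set of paths on `I` given by a single path: the class of a word `w` in which every element
of `I` appears exactly once. (On `I = ∅` it is the empty set of paths.) -/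
def ofWord {V : Type*} [DecidableEq V] {I : Finset V} (w : List V) (hw : w.Nodup)
    (hI : w.toFinset = I) : SetOfPaths I where
  paths := {q | q.support.Nonempty ∧ q = UWord.mk w}
  nodup := by
    rintro q ⟨-, rfl⟩
    exact hw
  nonempty := fun q hq => hq.1
  disjoint := by
    rintro q ⟨-, rfl⟩ q' ⟨-, rfl⟩ hne
    exact absurd rfl hne
  cover := by
    intro v
    subst hI
    constructor
    · intro hv
      exact ⟨UWord.mk w, ⟨⟨v, hv⟩, rfl⟩, hv⟩
    · rintro ⟨q, ⟨-, rfl⟩, hv⟩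
      exact hv

/-- `α` consists of a single path on `I`, and `w` is one of the two total orderings of `I` that
represent this path. -/
def IsPathWithWord {V : Type*} [DecidableEq V] {I : Finset V} (α : SetOfPaths I) (w : List V) :
    Prop :=
  ∃ (hw : w.Nodup) (hI : w.toFinset = I), α = ofWord w hw hI

end SetOfPaths

/-- The vector space `F[I]`, free on the sets of paths on `I`. -/
abbrev F (𝕜 : Type*) [Field 𝕜] {V : Type*} [DecidableEq V] (I : Finset V) : Type _ :=
  SetOfPaths I →₀ 𝕜

/-- The coproduct `Δ_{S,T} : F[I] → F[S] ⊗ F[T]`, `α ↦ α_{|S} ⊗ α_{/S}`, for `I = S ⊔ T`. -/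
def coproduct (𝕜 : Type*) [Field 𝕜] {V : Type*} [DecidableEq V] {I : Finset V} (S T : Finset V)
    (hST : S ∪ T = I) (hd : Disjoint S T) : F 𝕜 I →ₗ[𝕜] F 𝕜 S ⊗[𝕜] F 𝕜 T :=
  Finsupp.linearCombination 𝕜 fun α : SetOfPaths I =>
    (Finsupp.single (α.restrict S (hST ▸ Finset.subset_union_left)) 1 : F 𝕜 S) ⊗ₜ[𝕜]
      (Finsupp.single (α.contract S T hST hd) 1 : F 𝕜 T)

open Classical in
/-- The character `ζ_I : F[I] → 𝕜` that sends discrete sets of paths to `1` and the other sets of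
paths to `0`. -/
def zeta (𝕜 : Type*) [Field 𝕜] {V : Type*} [DecidableEq V] (I : Finset V) : F 𝕜 I →ₗ[𝕜] 𝕜 :=
  Finsupp.linearCombination 𝕜 fun α : SetOfPaths I => if α.IsDiscrete then 1 else 0

/-- The canonical isomorphism `F[∅] ≅ 𝕜`, sending the empty set of paths to `1`. -/
def counit (𝕜 : Type*) [Field 𝕜] {V : Type*} [DecidableEq V] (I : Finset V) : F 𝕜 I →ₗ[𝕜] 𝕜 :=
  Finsupp.linearCombination 𝕜 fun _ : SetOfPaths I => 1

/-! ### Decompositions, iterated coproducts and the basic invariant -/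

/-- `(S₁, …, S_n) ⊢ I`: the sets are pairwise disjoint, possibly empty, with union `I`. -/
def IsDecomposition {V : Type*} [DecidableEq V] {n : ℕ} (S : Fin n → Finset V) (I : Finset V) :
    Prop :=
  (∀ i j, i ≠ j → Disjoint (S i) (S j)) ∧ Finset.univ.biUnion S = I

theorem IsDecomposition.union_tail {V : Type*} [DecidableEq V] {n : ℕ} {S : Fin (n + 1) → Finset V}
    {I : Finset V} (h : IsDecomposition S I) :
    S 0 ∪ Finset.univ.biUnion (fun i : Fin n => S i.succ) = I := by
  rw [← h.2]
  ext v
  simp [Fin.exists_fin_succ]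

theorem IsDecomposition.disjoint_tail {V : Type*} [DecidableEq V] {n : ℕ}
    {S : Fin (n + 1) → Finset V} {I : Finset V} (h : IsDecomposition S I) :
    Disjoint (S 0) (Finset.univ.biUnion (fun i : Fin n => S i.succ)) := by
  rw [Finset.disjoint_biUnion_right]
  exact fun i _ => h.1 _ _ (Fin.succ_ne_zero i).symm

theorem IsDecomposition.tail {V : Type*} [DecidableEq V] {n : ℕ} {S : Fin (n + 1) → Finset V}
    {I : Finset V} (h : IsDecomposition S I) :
    IsDecomposition (fun i : Fin n => S i.succ)
      (Finset.univ.biUnion (fun i : Fin n => S i.succ)) :=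
  ⟨fun _ _ hij => h.1 _ _ (fun e => hij (Fin.succ_injective n e)), rfl⟩

/-- The decompositions of `I` of length `n`. -/
def decompositions {V : Type*} [DecidableEq V] (I : Finset V) (n : ℕ) :
    Finset (Fin n → Finset V) :=
  open Classical in
  (Fintype.piFinset fun _ : Fin n => I.powerset).filter fun S => IsDecomposition S I

theorem mem_decompositions {V : Type*} [DecidableEq V] {I : Finset V} {n : ℕ}
    {S : Fin n → Finset V} : S ∈ decompositions I n ↔ IsDecomposition S I := by
  simp only [decompositions, Finset.mem_filter, Fintype.mem_piFinset, Finset.mem_powerset,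
    and_iff_right_iff_imp]
  intro h i
  rw [← h.2]
  exact Finset.subset_biUnion_of_mem S (Finset.mem_univ i)

/-- The canonical map `M₀ ⊗ (M₁ ⊗ ⋯ ⊗ M_n) → M₀ ⊗ M₁ ⊗ ⋯ ⊗ M_n`. -/
def consTensor (𝕜 : Type*) [Field 𝕜] {n : ℕ} (M : Fin (n + 1) → Type*)
    [∀ i, AddCommGroup (M i)] [∀ i, Module 𝕜 (M i)] :
    M 0 ⊗[𝕜] (⨂[𝕜] i : Fin n, M i.succ) →ₗ[𝕜] ⨂[𝕜] i, M i :=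
  TensorProduct.lift
    ((PiTensorProduct.lift (R := 𝕜) (s := fun i : Fin n => M i.succ)
        (E := ⨂[𝕜] i, M i)).toLinearMap ∘ₗ (PiTensorProduct.tprod 𝕜 (s := M)).curryLeft)

/-- The iterated coproduct `Δ_{S₁, …, S_n} : F[I] → F[S₁] ⊗ ⋯ ⊗ F[S_n]`, defined by
`Δ_{S₁, …, S_n} = (id ⊗ Δ_{S₂, …, S_n}) ∘ Δ_{S₁, S₂ ⊔ ⋯ ⊔ S_n}`. -/
def iteratedCoproduct (𝕜 : Type*) [Field 𝕜] {V : Type*} [DecidableEq V] :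
    ∀ {n : ℕ} (S : Fin n → Finset V) {I : Finset V}, IsDecomposition S I →
      (F 𝕜 I →ₗ[𝕜] ⨂[𝕜] i, F 𝕜 (S i))
  | 0, _, I, _ => (PiTensorProduct.isEmptyEquiv (Fin 0)).symm.toLinearMap ∘ₗ counit 𝕜 I
  | _ + 1, S, _, h =>
    consTensor 𝕜 (fun i => F 𝕜 (S i)) ∘ₗ
      TensorProduct.map LinearMap.id (iteratedCoproduct 𝕜 (fun i => S i.succ) h.tail) ∘ₗ
        coproduct 𝕜 (S 0) _ h.union_tail h.disjoint_tail

/-- `ζ_{S₁} ⊗ ⋯ ⊗ ζ_{S_n} : F[S₁] ⊗ ⋯ ⊗ F[S_n] → 𝕜`. -/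
def zetaTensor (𝕜 : Type*) [Field 𝕜] {V : Type*} [DecidableEq V] {n : ℕ} (S : Fin n → Finset V) :
    (⨂[𝕜] i, F 𝕜 (S i)) →ₗ[𝕜] 𝕜 :=
  PiTensorProduct.lift
    ((MultilinearMap.mkPiAlgebra 𝕜 (Fin n) 𝕜).compLinearMap fun i => zeta 𝕜 (S i))

/-- The basic invariant
`χ_I(x)(n) = ∑_{(S₁, …, S_n) ⊢ I} (ζ_{S₁} ⊗ ⋯ ⊗ ζ_{S_n}) (Δ_{S₁, …, S_n}(x))`, for `n ∈ ℕ`. -/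
def chi (𝕜 : Type*) [Field 𝕜] {V : Type*} [DecidableEq V] {I : Finset V} (x : F 𝕜 I) (n : ℕ) : 𝕜 :=
  ∑ S : {S : Fin n → Finset V // S ∈ decompositions I n},
    zetaTensor 𝕜 S.1 (iteratedCoproduct 𝕜 S.1 (mem_decompositions.1 S.2) x)

/-- The polynomial `P` takes the values of the basic invariant of `x` at all `n ∈ ℕ`. -/
def IsBasicInvariantPolynomial {𝕜 : Type*} [Field 𝕜] {V : Type*} [DecidableEq V] {I : Finset V}
    (x : F 𝕜 I) (P : Polynomial 𝕜) : Prop :=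
  ∀ n : ℕ, P.eval (n : 𝕜) = chi 𝕜 x n

/-! ### Binary trees and colorings -/

/-- The sequence of labels of a binary tree, read from left to right (left subtree, root, right
subtree). -/
def inorder {V : Type*} : BinaryTree V → List V
  | .nil => []
  | .node a l r => inorder l ++ a :: inorder r

/-- The label of the root, if there is one. -/
def root? {V : Type*} : BinaryTree V → Option V
  | .nil => none
  | .node a _ _ => some a

/-- `IsChild t u v`: some vertex of `t` labelled `u` is a child of a vertex labelled `v`. -/
def IsChild {V : Type*} : BinaryTree V → V → V → Prop
  | .nil, _, _ => False
  | .node a l r, u, v =>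
    (v = a ∧ (root? l = some u ∨ root? r = some u)) ∨ IsChild l u v ∨ IsChild r u v

/-- `t'` is the binary tree `t` with its vertices identified with the letters of `w` from left to
right, so that a vertex is carried to the letter with the same number of letters on its left. -/
def IsLabelling {V : Type*} (w : List V) (t : BinaryTree Unit) (t' : BinaryTree V) : Prop :=
  t'.map (fun _ => ()) = t ∧ inorder t' = w

/-- The coloring `c : I → [n]` is compatible with the tree `t`, whose vertices are identified with
the elements of `I` along `w`: on every edge, oriented to the parent, the parent has maximal
color. -/
def Compatible {V : Type*} {I : Finset V} {n : ℕ} (w : List V) (t : BinaryTree Unit)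
    (c : I → Fin n) : Prop :=
  ∃ t', IsLabelling w t t' ∧ ∀ u v : I, IsChild t' (u : V) (v : V) → c u ≤ c v

/-- Strict compatibility: on every edge the parent is the unique vertex of maximal color. -/
def StrictlyCompatible {V : Type*} {I : Finset V} {n : ℕ} (w : List V) (t : BinaryTree Unit)
    (c : I → Fin n) : Prop :=
  ∃ t', IsLabelling w t t' ∧ ∀ u v : I, IsChild t' (u : V) (v : V) → c u < c v

/-- The number of compatible pairs (binary tree with `|I|` vertices, coloring with `[n]`). -/
def numCompatible {V : Type*} (I : Finset V) (w : List V) (n : ℕ) : ℕ :=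
  Nat.card {p : BinaryTree Unit × (I → Fin n) // p.1.numNodes = I.card ∧ Compatible w p.1 p.2}

/-- The number of strictly compatible pairs (binary tree with `|I|` vertices, coloring with
`[n]`). -/
def numStrictlyCompatible {V : Type*} (I : Finset V) (w : List V) (n : ℕ) : ℕ :=
  Nat.card
    {p : BinaryTree Unit × (I → Fin n) // p.1.numNodes = I.card ∧ StrictlyCompatible w p.1 p.2}

end PathMonoid

end

/-!
A tree that is strictly compatible with a coloring `c` is a tree with in-order word `w` whose
vertices are heap-ordered by color. There is at most one: its root is the unique letter of maximal
color, and the two factors of `w` cut out by this letter are the words of its subtrees. Hence it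
exists if and only if the maximal color occurs at most once in `w`, the next color at most once in
each of the factors cut out by the maximal one, and so on. This is what `ζ ⊗ ⋯ ⊗ ζ` tests on
`Δ_{S₁, …, S_n}(α)` when `S₁, …, S_n` are the color classes in decreasing order of colors, so
`χ(α)(n)` counts the strictly compatible pairs.

Cutting trees at the root, the numbers `s_m(n)` and `c_m(n)` of strictly compatible and of
compatible pairs for trees with `m` vertices satisfy `s_0 = c_0 = 1`, `s_{m+1}(0) = c_{m+1}(0) = 0`
and

* `s_{m+1}(n+1) - s_{m+1}(n) = ∑_{i+j=m} s_i(n) s_j(n)`,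
* `c_{m+1}(n+1) - c_{m+1}(n) = ∑_{i+j=m} c_i(n+1) c_j(n+1)`.

The first recursion makes `s_m` a polynomial, and the substitution `n ↦ -n` together with the sign
`(-1)^m` turns it into the second one. For `n = 1` the latter is the recursion of the Catalan
numbers.
-/

namespace PathMonoid

/-! ### Relabelling binary trees -/

section Trees

variable {V W : Type*}

theorem mem_inorder_of_root? {t : BinaryTree V} {u : V} (h : root? t = some u) :
    u ∈ inorder t := by
  cases t with
  | nil => cases h
  | node a l r => obtain rfl := Option.some.inj h; simp [inorder]

theorem root?_map (f : V → W) (t : BinaryTree V) : root? (t.map f) = (root? t).map f := by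
  cases t <;> rfl

theorem inorder_map (f : V → W) (t : BinaryTree V) :
    inorder (t.map f) = (inorder t).map f := by
  induction t with
  | nil => rfl
  | node a l r hl hr => simp [BinaryTree.map, inorder, hl, hr]

theorem length_inorder (t : BinaryTree V) : (inorder t).length = t.numNodes := by
  induction t with
  | nil => rfl
  | node a l r hl hr => simp [inorder, hl, hr, add_assoc]

theorem numNodes_map (f : V → W) (t : BinaryTree V) : (t.map f).numNodes = t.numNodes := by
  rw [← length_inorder, inorder_map, List.length_map, length_inorder]

theorem isChild_map (f : V → W) (t : BinaryTree V) :
    IsChild (t.map f) = Relation.Map (IsChild t) f f := by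
  induction t with
  | nil => ext u v; simp [BinaryTree.map, IsChild, Relation.Map]
  | node a l r hl hr =>
    ext u v
    simp only [BinaryTree.map, IsChild, hl, hr, root?_map, Relation.Map, Option.map_eq_some_iff]
    aesop

theorem eq_of_map_const_eq_of_inorder_eq {t t' : BinaryTree V}
    (hshape : t.map (fun _ => ()) = t'.map (fun _ => ())) (hword : inorder t = inorder t') :
    t = t' := by
  induction t generalizing t' with
  | nil => cases t' with
    | nil => rfl
    | node => cases hshape
  | node a l r hl hr => cases t' with
    | nil => cases hshape
    | node a' l' r' =>
      simp only [BinaryTree.map, BinaryTree.node.injEq, true_and] at hshape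
      have hlength : (inorder l).length = (inorder l').length := by
        simpa only [length_inorder, numNodes_map] using
          congrArg BinaryTree.numNodes hshape.1
      obtain ⟨hleft, hright⟩ := List.append_inj hword hlength
      obtain ⟨rfl, htail⟩ := List.cons.inj hright
      rw [hl hshape.1 hleft, hr hshape.2 htail]

theorem map_injective {f : V → W} (hf : Function.Injective f) :
    Function.Injective (BinaryTree.map f) := by
  intro t t' h
  refine eq_of_map_const_eq_of_inorder_eq ?_ ?_
  · simpa only [← BinaryTree.comp_map] using congrArg (BinaryTree.map fun _ => ()) h
  · exact List.map_injective_iff.2 hf (by simpa only [inorder_map] using congrArg inorder h)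

theorem exists_map_eq_of_inorder_eq_map {f : V → W} {t : BinaryTree W} {w : List V}
    (h : inorder t = w.map f) : ∃ s : BinaryTree V, s.map f = t ∧ inorder s = w := by
  induction t generalizing w with
  | nil => exact ⟨.nil, rfl, (List.map_eq_nil_iff.1 h.symm).symm⟩
  | node a l r hl hr =>
    obtain ⟨x, z, rfl, hx, hz⟩ := List.map_eq_append_iff.1 h.symm
    obtain ⟨b, y, rfl, rfl, hy⟩ := List.map_eq_cons_iff.1 hz
    obtain ⟨l', rfl, rfl⟩ := hl hx.symm
    obtain ⟨r', rfl, rfl⟩ := hr hy.symm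
    exact ⟨.node b l' r', rfl, rfl⟩

theorem exists_isLabelling_map_iff {f : V → W} {w : List V} {t : BinaryTree Unit}
    {P : BinaryTree W → Prop} :
    (∃ t', IsLabelling (w.map f) t t' ∧ P t') ↔ ∃ s, IsLabelling w t s ∧ P (s.map f) := by
  constructor
  · rintro ⟨_, ⟨rfl, hword⟩, hP⟩
    obtain ⟨s, rfl, rfl⟩ := exists_map_eq_of_inorder_eq_map hword
    exact ⟨s, ⟨BinaryTree.comp_map f (fun _ => ()) s, rfl⟩, hP⟩
  · rintro ⟨s, ⟨rfl, rfl⟩, hP⟩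
    exact ⟨s.map f, ⟨(BinaryTree.comp_map f (fun _ => ()) s).symm, inorder_map f s⟩, hP⟩

end Trees

/-! ### Heap-ordered trees -/

section Heaps

variable {V W : Type*} {R : V → V → Prop}

/-- The labels of `t` are heap-ordered: each vertex is `R`-related to its parent, so that, for `R`
an order, the labels increase towards the root. -/
def IsHeap (R : V → V → Prop) (t : BinaryTree V) : Prop :=
  ∀ u v, IsChild t u v → R u v

theorem isHeap_nil : IsHeap R .nil := fun _ _ h => h.elim

theorem isHeap_node {a : V} {l r : BinaryTree V} :
    IsHeap R (.node a l r) ↔ (∀ u, root? l = some u → R u a) ∧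
      (∀ u, root? r = some u → R u a) ∧ IsHeap R l ∧ IsHeap R r := by
  constructor
  · intro h
    exact ⟨fun u hu => h u a (.inl ⟨rfl, .inl hu⟩), fun u hu => h u a (.inl ⟨rfl, .inr hu⟩),
      fun u v huv => h u v (.inr (.inl huv)), fun u v huv => h u v (.inr (.inr huv))⟩
  · rintro ⟨hrootl, hrootr, hl, hr⟩ u v (⟨rfl, h | h⟩ | h | h)
    exacts [hrootl u h, hrootr u h, hl u v h, hr u v h]

theorem isHeap_map {R : W → W → Prop} {f : V → W} {t : BinaryTree V} :
    IsHeap R (t.map f) ↔ IsHeap (fun u v => R (f u) (f v)) t := by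
  rw [IsHeap, isChild_map]
  exact ⟨fun h u v huv => h _ _ ⟨u, v, huv, rfl, rfl⟩,
    fun h _ _ ⟨u, v, huv, hu, hv⟩ => hu ▸ hv ▸ h u v huv⟩

theorem IsHeap.forall_mem_inorder {P : V → Prop} (hP : ∀ u v, R u v → P v → P u)
    {t : BinaryTree V} (h : IsHeap R t) (hroot : ∀ u, root? t = some u → P u) :
    ∀ u ∈ inorder t, P u := by
  induction t with
  | nil => simp [inorder]
  | node a l r hl hr =>
    obtain ⟨hrootl, hrootr, hheapl, hheapr⟩ := isHeap_node.1 h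
    have ha : P a := hroot a rfl
    simp only [inorder, List.forall_mem_append, List.forall_mem_cons]
    exact ⟨hl hheapl fun u hu => hP u a (hrootl u hu) ha, ha,
      hr hheapr fun u hu => hP u a (hrootr u hu) ha⟩

theorem isHeap_node_iff_of_trans [IsTrans V R] {a : V} {l r : BinaryTree V} :
    IsHeap R (.node a l r) ↔ (∀ u ∈ inorder l, R u a) ∧ (∀ u ∈ inorder r, R u a) ∧
      IsHeap R l ∧ IsHeap R r := by
  rw [isHeap_node]
  constructor
  · rintro ⟨hrootl, hrootr, hl, hr⟩
    exact ⟨hl.forall_mem_inorder (P := (R · a)) (fun _ _ => trans_of R) hrootl,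
      hr.forall_mem_inorder (P := (R · a)) (fun _ _ => trans_of R) hrootr, hl, hr⟩
  · rintro ⟨hdoml, hdomr, hl, hr⟩
    exact ⟨fun u hu => hdoml u (mem_inorder_of_root? hu),
      fun u hu => hdomr u (mem_inorder_of_root? hu), hl, hr⟩

/-- The mirror image of a binary tree, which is read along the reversed word. -/
def mirror : BinaryTree V → BinaryTree V
  | .nil => .nil
  | .node a l r => .node a (mirror r) (mirror l)

theorem inorder_mirror (t : BinaryTree V) : inorder (mirror t) = (inorder t).reverse := by
  induction t with
  | nil => rfl
  | node a l r hl hr => simp [mirror, inorder, hl, hr]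

theorem root?_mirror (t : BinaryTree V) : root? (mirror t) = root? t := by
  cases t <;> rfl

theorem isHeap_mirror {t : BinaryTree V} : IsHeap R (mirror t) ↔ IsHeap R t := by
  induction t with
  | nil => rfl
  | node a l r hl hr =>
    simp only [mirror, isHeap_node, root?_mirror, hl, hr]
    tauto

theorem IsHeap.eq_of_inorder_node_eq [IsTrans V R] {a b : V} {l r : BinaryTree V} {x y : List V}
    (h : IsHeap R (.node b l r)) (hword : inorder (.node b l r) = x ++ a :: y)
    (hmax : ∀ u ∈ x ++ a :: y, ¬ R a u) : b = a ∧ inorder l = x ∧ inorder r = y := by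
  obtain ⟨hdoml, hdomr, -, -⟩ := isHeap_node_iff_of_trans.1 h
  have hb : ¬ R a b := hmax b (by rw [← hword]; simp [inorder])
  have hl : a ∉ inorder l := fun ha => hb (hdoml a ha)
  have hr : a ∉ inorder r := fun ha => hb (hdomr a ha)
  have ha : a ∈ inorder (.node b l r) := by rw [hword]; simp
  obtain rfl : a = b := by simpa [inorder, hl, hr] using ha
  obtain ⟨hleft, -, hright⟩ := (List.append_cons_inj_of_notMem hl hr).1 hword
  exact ⟨rfl, hleft, hright⟩

theorem IsHeap.eq_of_inorder_eq [IsTrans V R] [Std.Asymm R] {t t' : BinaryTree V}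
    (h : IsHeap R t) (h' : IsHeap R t') (hword : inorder t = inorder t') : t = t' := by
  induction t generalizing t' with
  | nil => cases t' with
    | nil => rfl
    | node => simp [inorder] at hword
  | node a l r hl hr => cases t' with
    | nil => simp [inorder] at hword
    | node a' l' r' =>
      obtain ⟨-, -, hheapl, hheapr⟩ := isHeap_node_iff_of_trans.1 h
      obtain ⟨hdoml, hdomr, hheapl', hheapr'⟩ := isHeap_node_iff_of_trans.1 h'
      have hmax : ∀ u ∈ inorder l' ++ a' :: inorder r', ¬ R a' u := by
        simp only [List.forall_mem_append, List.forall_mem_cons]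
        exact ⟨fun u hu => asymm_of R (hdoml u hu), irrefl_of R a',
          fun u hu => asymm_of R (hdomr u hu)⟩
      obtain ⟨rfl, hleft, hright⟩ := h.eq_of_inorder_node_eq hword hmax
      rw [hl hheapl hheapl' hleft, hr hheapr hheapr' hright]

/-- Some binary tree with in-order word `w` is heap-ordered. For a strict order `R` there is at most
one, the Cartesian tree of `w`. -/
def HasHeap (R : V → V → Prop) (w : List V) : Prop :=
  ∃ t, inorder t = w ∧ IsHeap R t

theorem hasHeap_nil : HasHeap R [] := ⟨.nil, rfl, isHeap_nil⟩

theorem HasHeap.reverse {w : List V} : HasHeap R w → HasHeap R w.reverse := by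
  rintro ⟨t, rfl, ht⟩
  exact ⟨mirror t, inorder_mirror t, isHeap_mirror.2 ht⟩

theorem hasHeap_map {R : W → W → Prop} {f : V → W} {w : List V} :
    HasHeap R (w.map f) ↔ HasHeap (fun u v => R (f u) (f v)) w := by
  constructor
  · rintro ⟨_, hword, ht⟩
    obtain ⟨s, rfl, hs⟩ := exists_map_eq_of_inorder_eq_map hword
    exact ⟨s, hs, isHeap_map.1 ht⟩
  · rintro ⟨s, rfl, hs⟩
    exact ⟨s.map f, inorder_map f s, isHeap_map.2 hs⟩

theorem hasHeap_append_cons_iff [IsTrans V R] {a : V} {x y : List V}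
    (hdom : ∀ u ∈ x ++ y, R u a) (hmax : ∀ u ∈ x ++ a :: y, ¬ R a u) :
    HasHeap R (x ++ a :: y) ↔ HasHeap R x ∧ HasHeap R y := by
  constructor
  · rintro ⟨t, hword, ht⟩
    cases t with
    | nil => simp [inorder] at hword
    | node b l r =>
      obtain ⟨-, hleft, hright⟩ := ht.eq_of_inorder_node_eq hword hmax
      obtain ⟨-, -, hl, hr⟩ := isHeap_node.1 ht
      exact ⟨⟨l, hleft, hl⟩, ⟨r, hright, hr⟩⟩
  · rintro ⟨⟨l, rfl, hl⟩, ⟨r, rfl, hr⟩⟩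
    obtain ⟨hdoml, hdomr⟩ := List.forall_mem_append.1 hdom
    exact ⟨.node a l r, rfl, isHeap_node_iff_of_trans.2 ⟨hdoml, hdomr, hl, hr⟩⟩

theorem HasHeap.length_filter_le_one [IsTrans V R] {f : V → Bool} {w : List V}
    (h : HasHeap R w) (hmax : ∀ v ∈ w, f v → ∀ u ∈ w, ¬ R v u) :
    (w.filter f).length ≤ 1 := by
  rcases hfilter : w.filter f with _ | ⟨a, rest⟩
  · simp
  obtain ⟨x, y, rfl, hx, ha, rfl⟩ := List.filter_eq_cons_iff.1 hfilter
  obtain ⟨t, hword, ht⟩ := h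
  cases t with
  | nil => simp [inorder] at hword
  | node b l r =>
    obtain ⟨rfl, rfl, rfl⟩ := ht.eq_of_inorder_node_eq hword (hmax a (by simp) ha)
    obtain ⟨-, hdomr, -, -⟩ := isHeap_node_iff_of_trans.1 ht
    suffices (inorder r).filter f = [] by simp [this]
    refine List.filter_eq_nil_iff.2 fun v hv hfv => ?_
    exact hmax v (by simp [hv]) hfv b (by simp) (hdomr v hv)

theorem hasHeap_iff_splitOnP [IsTrans V R] {f : V → Bool} {w : List V}
    (hmax : ∀ v ∈ w, f v → ∀ u ∈ w, ¬ R v u)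
    (hdom : ∀ u ∈ w, ¬ f u → ∀ v ∈ w, f v → R u v) :
    HasHeap R w ↔ (w.filter f).length ≤ 1 ∧ ∀ p ∈ w.splitOnP f, HasHeap R p := by
  suffices (w.filter f).length ≤ 1 → (HasHeap R w ↔ ∀ p ∈ w.splitOnP f, HasHeap R p) from
    ⟨fun h => ⟨h.length_filter_le_one hmax, (this (h.length_filter_le_one hmax)).1 h⟩,
      fun h => (this h.1).2 h.2⟩
  intro hlength
  rcases hfilter : w.filter f with _ | ⟨a, rest⟩
  · rw [List.splitOnP_eq_singleton (by simpa using List.filter_eq_nil_iff.1 hfilter)]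
    simp
  obtain rfl : rest = [] := by simpa [hfilter] using hlength
  obtain ⟨x, y, rfl, hx, ha, hy⟩ := List.filter_eq_cons_iff.1 hfilter
  replace hy := List.filter_eq_nil_iff.1 hy
  have hdoma : ∀ u ∈ x ++ y, R u a := by
    rw [List.forall_mem_append]
    exact ⟨fun u hu => hdom u (by simp [hu]) (hx u hu) a (by simp) ha,
      fun u hu => hdom u (by simp [hu]) (hy u hu) a (by simp) ha⟩
  rw [hasHeap_append_cons_iff hdoma (hmax a (by simp) ha), List.splitOnP_append_cons _ _ ha,
    List.splitOnP_eq_singleton (by simpa using hx), List.splitOnP_eq_singleton (by simpa using hy)]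
  simp

end Heaps

/-! ### Counting colored trees -/

section Counting

open Finset HasAntidiagonal

variable {b : ℕ → ℕ} {m n : ℕ}

/-- The binary trees with `m` vertices colored by natural numbers, such that the color of the root
is less than `n` and the color of each child of a vertex of color `v` is less than `b v`. Taking
`b = id` and `b = Nat.succ` gives the strictly and the weakly compatible colorings by
`{0, …, n - 1}`. -/
def coloredTrees (b : ℕ → ℕ) : ℕ → ℕ → Finset (BinaryTree ℕ)
  | 0, _ => {.nil}
  | m + 1, n => (range n ×ˢ (antidiagonal m).attach).biUnion fun q =>
      image₂ (.node q.1) (coloredTrees b q.2.1.1 (b q.1)) (coloredTrees b q.2.1.2 (b q.1))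
termination_by m => m
decreasing_by
  all_goals have := mem_antidiagonal.1 q.2.2; lia

theorem node_mem_coloredTrees_succ {a : ℕ} {l r : BinaryTree ℕ} :
    .node a l r ∈ coloredTrees b (m + 1) n ↔ a < n ∧ ∃ p ∈ antidiagonal m,
      l ∈ coloredTrees b p.1 (b a) ∧ r ∈ coloredTrees b p.2 (b a) := by
  simp only [coloredTrees, mem_biUnion, mem_image₂, mem_product, mem_range, mem_attach, and_true,
    BinaryTree.node.injEq]
  constructor
  · rintro ⟨⟨k, p⟩, hk, l, hl, r, hr, rfl, rfl, rfl⟩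
    exact ⟨hk, p.1, p.2, hl, hr⟩
  · rintro ⟨hk, p, hp, hl, hr⟩
    exact ⟨(a, ⟨p, hp⟩), hk, l, hl, r, hr, rfl, rfl, rfl⟩

theorem mem_coloredTrees {t : BinaryTree ℕ} :
    t ∈ coloredTrees b m n ↔
      t.numNodes = m ∧ (∀ u, root? t = some u → u < n) ∧ IsHeap (fun u v => u < b v) t := by
  induction t generalizing m n with
  | nil => cases m <;> simp [coloredTrees, root?, isHeap_nil]
  | node a l r hl hr =>
    have hroot : root? (.node a l r) = some a := rfl
    cases m with
    | zero => simp [coloredTrees]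
    | succ m =>
      simp only [node_mem_coloredTrees_succ, hl, hr, HasAntidiagonal.mem_antidiagonal,
        Prod.exists, BinaryTree.numNodes, hroot, Option.some.injEq, forall_eq', isHeap_node]
      grind

theorem card_coloredTrees_zero (b : ℕ → ℕ) (n : ℕ) : #(coloredTrees b 0 n) = 1 := by
  simp [coloredTrees]

theorem card_coloredTrees_succ_zero (b : ℕ → ℕ) (m : ℕ) : #(coloredTrees b (m + 1) 0) = 0 := by
  simp [coloredTrees]

theorem card_coloredTrees_succ (b : ℕ → ℕ) (m n : ℕ) :
    #(coloredTrees b (m + 1) n) = ∑ k ∈ range n, ∑ p ∈ antidiagonal m,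
      #(coloredTrees b p.1 (b k)) * #(coloredTrees b p.2 (b k)) := by
  rw [coloredTrees, card_biUnion, sum_product]
  · refine sum_congr rfl fun k _ => ?_
    rw [← sum_attach (antidiagonal m)]
    refine sum_congr rfl fun p _ => card_image₂ (fun l l' r r' h => ?_) _ _
    simpa using h
  · rintro ⟨k, p, hp⟩ - ⟨k', p', hp'⟩ - hne
    rw [Function.onFun, disjoint_left]
    simp only [mem_image₂, mem_coloredTrees]
    rintro _ ⟨l, ⟨hl, -⟩, r, ⟨hr, -⟩, rfl⟩ ⟨l', ⟨hl', -⟩, r', ⟨hr', -⟩, h⟩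
    grind

theorem card_coloredTrees_succ_succ (b : ℕ → ℕ) (m n : ℕ) :
    #(coloredTrees b (m + 1) (n + 1)) = #(coloredTrees b (m + 1) n) +
      ∑ p ∈ antidiagonal m, #(coloredTrees b p.1 (b n)) * #(coloredTrees b p.2 (b n)) := by
  rw [card_coloredTrees_succ, card_coloredTrees_succ, sum_range_succ]

theorem card_coloredTrees_succ_one (m : ℕ) : #(coloredTrees Nat.succ m 1) = catalan m := by
  induction m using Nat.strong_induction_on with
  | _ m ih =>
    cases m with
    | zero => rw [card_coloredTrees_zero, catalan_zero]
    | succ m =>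
      rw [card_coloredTrees_succ_succ, card_coloredTrees_succ_zero, zero_add, catalan_succ']
      refine sum_congr rfl fun p hp => ?_
      have hpm := mem_antidiagonal.1 hp
      rw [ih p.1 (by lia), ih p.2 (by lia)]

end Counting

/-! ### Polynomiality and reciprocity -/

section Polynomials

open Polynomial Finset HasAntidiagonal

variable {R : Type*} [CommRing R]

theorem polynomial_eq_of_eval_natCast_eq [IsDomain R] [CharZero R] {p q : R[X]}
    (h : ∀ n : ℕ, p.eval (n : R) = q.eval (n : R)) : p = q := by
  refine Polynomial.eq_of_infinite_eval_eq p q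
    ((Set.infinite_range_of_injective Nat.cast_injective).mono ?_)
  rintro _ ⟨n, rfl⟩
  exact h n

variable [Algebra ℚ R]

/-- The polynomial with forward difference `p` and value `0` at `0`, obtained from the Bernoulli
polynomials: the forward difference of `bernoulli (k + 1)` is `(k + 1) X ^ k`. -/
noncomputable def indefiniteSum (p : R[X]) : R[X] :=
  let q := p.sum fun k a =>
    C (a * algebraMap ℚ R (k + 1)⁻¹) * (Polynomial.bernoulli (k + 1)).map (algebraMap ℚ R)
  q - C (q.eval 0)

theorem eval_zero_indefiniteSum (p : R[X]) : (indefiniteSum p).eval 0 = 0 := by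
  simp only [indefiniteSum, eval_sub, eval_C, sub_self]

theorem map_bernoulli_comp_X_add_one (k : ℕ) :
    ((Polynomial.bernoulli (k + 1)).map (algebraMap ℚ R)).comp (X + 1) =
      (Polynomial.bernoulli (k + 1)).map (algebraMap ℚ R) +
        C (algebraMap ℚ R (k + 1)) * X ^ k := by
  have h := congrArg (Polynomial.map (algebraMap ℚ R)) (Polynomial.bernoulli_comp_one_add_X (k + 1))
  simpa [add_comm, Polynomial.map_comp] using h

theorem indefiniteSum_comp_X_add_one (p : R[X]) :
    (indefiniteSum p).comp (X + 1) = indefiniteSum p + p := by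
  have hterm (k : ℕ) (a : R) :
      (C (a * algebraMap ℚ R (k + 1)⁻¹) *
        (Polynomial.bernoulli (k + 1)).map (algebraMap ℚ R)).comp (X + 1) =
      C (a * algebraMap ℚ R (k + 1)⁻¹) * (Polynomial.bernoulli (k + 1)).map (algebraMap ℚ R) +
        C a * X ^ k := by
    have hk : algebraMap ℚ R (k + 1)⁻¹ * algebraMap ℚ R (k + 1) = 1 := by
      rw [← map_mul, inv_mul_cancel₀ k.cast_add_one_ne_zero, map_one]
    rw [mul_comp, C_comp, map_bernoulli_comp_X_add_one, mul_add, ← mul_assoc (C _), ← C_mul,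
      mul_assoc a, hk, mul_one]
  simp only [indefiniteSum, sub_comp, C_comp, Polynomial.sum_def, Polynomial.sum_comp, hterm,
    Finset.sum_add_distrib]
  rw [← as_sum_support_C_mul_X_pow]
  ring

/-- The polynomial in `n` counting the strictly compatible pairs of a binary tree with `m` vertices
and a coloring by `n` colors. -/
noncomputable def treePolynomial (R : Type*) [CommRing R] [Algebra ℚ R] : ℕ → R[X]
  | 0 => 1
  | m + 1 => indefiniteSum
      (∑ p ∈ (antidiagonal m).attach, treePolynomial R p.1.1 * treePolynomial R p.1.2)
termination_by m => m
decreasing_by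
  all_goals have := mem_antidiagonal.1 p.2; lia

theorem treePolynomial_succ (m : ℕ) :
    treePolynomial R (m + 1) =
      indefiniteSum (∑ p ∈ antidiagonal m, treePolynomial R p.1 * treePolynomial R p.2) := by
  rw [treePolynomial,
    sum_attach (antidiagonal m) fun p => treePolynomial R p.1 * treePolynomial R p.2]

theorem eval_zero_treePolynomial_succ (m : ℕ) : (treePolynomial R (m + 1)).eval 0 = 0 := by
  rw [treePolynomial_succ, eval_zero_indefiniteSum]

theorem eval_add_one_treePolynomial_succ (m : ℕ) (x : R) :
    (treePolynomial R (m + 1)).eval (x + 1) = (treePolynomial R (m + 1)).eval x +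
      ∑ p ∈ antidiagonal m, (treePolynomial R p.1).eval x * (treePolynomial R p.2).eval x := by
  have h := congrArg (eval x) (indefiniteSum_comp_X_add_one
    (∑ p ∈ antidiagonal m, treePolynomial R p.1 * treePolynomial R p.2))
  rw [← treePolynomial_succ] at h
  simpa [eval_comp, eval_finsetSum] using h

theorem eval_natCast_treePolynomial (m n : ℕ) :
    (treePolynomial R m).eval (n : R) = #(coloredTrees id m n) := by
  induction m using Nat.strong_induction_on generalizing n with
  | _ m ih =>
    rcases m with _ | m
    · simp [treePolynomial, card_coloredTrees_zero]
    induction n with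
    | zero => simp [eval_zero_treePolynomial_succ, card_coloredTrees_succ_zero]
    | succ n ihn =>
      rw [Nat.cast_succ, eval_add_one_treePolynomial_succ, ihn, card_coloredTrees_succ_succ]
      push_cast
      congr 1
      refine sum_congr rfl fun p hp => ?_
      have hpm := mem_antidiagonal.1 hp
      rw [ih p.1 (by lia), ih p.2 (by lia), id]

theorem neg_one_pow_mul_eval_neg_natCast_treePolynomial (m n : ℕ) :
    (-1) ^ m * (treePolynomial R m).eval (-(n : R)) = #(coloredTrees Nat.succ m n) := by
  induction m using Nat.strong_induction_on generalizing n with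
  | _ m ih =>
    rcases m with _ | m
    · simp [treePolynomial, card_coloredTrees_zero]
    induction n with
    | zero => simp [eval_zero_treePolynomial_succ, card_coloredTrees_succ_zero]
    | succ n ihn =>
      set x : R := -((n + 1 : ℕ) : R) with hx
      have hdiff := eval_add_one_treePolynomial_succ m x
      rw [show x + 1 = -(n : R) by rw [hx]; push_cast; ring] at hdiff
      have hsum : ∑ p ∈ antidiagonal m, (#(coloredTrees Nat.succ p.1 (n + 1)) : R) *
            #(coloredTrees Nat.succ p.2 (n + 1)) = (-1) ^ m *
          ∑ p ∈ antidiagonal m, (treePolynomial R p.1).eval x * (treePolynomial R p.2).eval x := by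
        rw [mul_sum]
        refine sum_congr rfl fun p hp => ?_
        have hpm := mem_antidiagonal.1 hp
        rw [← ih p.1 (by lia), ← ih p.2 (by lia), ← hpm]
        ring
      rw [card_coloredTrees_succ_succ]
      push_cast [Nat.succ_eq_add_one]
      rw [hsum, ← ihn, hdiff]
      ring

end Polynomials

/-! ### Evaluation of the basic invariant -/

namespace UWord

variable {V : Type*} {s : List V}

theorem mk_eq_mk_singleton {v : V} : mk s = mk [v] ↔ s = [v] := by
  rw [mk_eq_mk, eq_comm, ← List.reverse_eq_iff, List.reverse_singleton, eq_comm (a := [v]), or_self]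

theorem support_mk_nonempty [DecidableEq V] : (mk s).support.Nonempty ↔ s ≠ [] := by
  rw [support_mk, List.toFinset_nonempty_iff]

end UWord

namespace SetOfPaths

variable {V : Type*} [DecidableEq V] {I : Finset V} (α : SetOfPaths I)

theorem isDiscrete_restrict_iff (S : Finset V) (hS : S ⊆ I) :
    (α.restrict S hS).IsDiscrete ↔
      ∀ s, UWord.mk s ∈ α.paths → (s.filter (fun v => decide (v ∈ S))).length ≤ 1 := by
  constructor
  · intro h s hs
    by_cases hempty : s.filter (fun v => decide (v ∈ S)) = []
    · simp [hempty]
    · obtain ⟨v, hv⟩ := h _ ⟨UWord.support_mk_nonempty.2 hempty, UWord.mk s, hs, rfl⟩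
      rw [UWord.mk_eq_mk_singleton.1 hv]
      simp
  · rintro h q ⟨hq, p, hp, rfl⟩
    obtain ⟨s, rfl⟩ := p.exists_rep
    rw [UWord.restrict_mk, UWord.support_mk_nonempty] at hq
    obtain ⟨v, hv⟩ := List.length_eq_one_iff.1 (le_antisymm (h s hp) (List.length_pos_iff.2 hq))
    exact ⟨v, by rw [UWord.restrict_mk, hv]⟩

theorem forall_mk_mem_contract_paths_iff (S T : Finset V) (hST : S ∪ T = I) (hd : Disjoint S T)
    {Q : List V → Prop} (hQ : Q []) :
    (∀ s, UWord.mk s ∈ (α.contract S T hST hd).paths → Q s) ↔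
      ∀ s, UWord.mk s ∈ α.paths → ∀ p ∈ s.splitOnP (fun v => decide (v ∈ S)), Q p := by
  constructor
  · intro h s hs p hp
    by_cases hempty : p = []
    · rwa [hempty]
    · exact h p ⟨UWord.support_mk_nonempty.2 hempty, UWord.mk s, hs, s, p, rfl, hp, rfl⟩
  · rintro h s ⟨-, _, hw, w, s', rfl, hs', hmk⟩
    rcases UWord.mk_eq_mk.1 hmk with rfl | rfl
    · exact h w hw _ hs'
    · refine h w.reverse ?_ _ ?_
      · rwa [UWord.mk_eq_mk.2 (.inr (List.reverse_reverse w).symm)]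
      · rw [splitOnP_reverse]
        simpa using hs'

variable {α}

theorem mem_of_mem_of_mk_mem {s : List V} (hs : UWord.mk s ∈ α.paths) {v : V} (hv : v ∈ s) :
    v ∈ I :=
  (α.cover v).2 ⟨_, hs, by simpa using hv⟩

theorem IsPathWithWord.forall_mk_mem_paths_hasHeap_iff {w : List V} (hα : α.IsPathWithWord w)
    {R : V → V → Prop} : (∀ s, UWord.mk s ∈ α.paths → HasHeap R s) ↔ HasHeap R w := by
  obtain ⟨hw, hI, rfl⟩ := hα
  constructor
  · intro h
    by_cases hempty : w = []
    · rw [hempty]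
      exact hasHeap_nil
    · exact h w ⟨UWord.support_mk_nonempty.2 hempty, rfl⟩
  · rintro h s ⟨-, hs⟩
    rcases UWord.mk_eq_mk.1 hs with rfl | rfl
    · exact h
    · simpa using h.reverse

end SetOfPaths

section Colorings

variable {V : Type*} {I : Finset V} {n : ℕ}

/-- The color classes of a coloring, in decreasing order of colors: the letters erased first by the
iterated coproduct are those of the largest color. -/
def colorClasses (c : I → Fin n) (i : Fin n) : Finset V :=
  (Finset.univ.filter fun v => c v = i.rev).map (Function.Embedding.subtype _)

theorem mem_colorClasses {c : I → Fin n} {i : Fin n} {v : V} :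
    v ∈ colorClasses c i ↔ ∃ h : v ∈ I, c ⟨v, h⟩ = i.rev := by
  simp [colorClasses]

/-- The strict comparison of the colors of the elements of `I`, as a relation on all letters. -/
def ColorLT (c : I → Fin n) : V → V → Prop :=
  Relation.Map (fun u v => c u < c v) (↑) (↑)

theorem colorLT_coe {c : I → Fin n} {u v : I} :
    ColorLT c u v ↔ c u < c v :=
  Relation.map_apply_apply Subtype.val_injective Subtype.val_injective _ _ _

instance (c : I → Fin n) : IsTrans V (ColorLT c) where
  trans := by
    rintro _ _ _ ⟨u, v, huv, rfl, rfl⟩ ⟨v', z, hvz, hv, rfl⟩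
    obtain rfl := Subtype.val_injective hv
    exact colorLT_coe.2 (huv.trans hvz)

variable [DecidableEq V]

theorem isDecomposition_colorClasses (c : I → Fin n) : IsDecomposition (colorClasses c) I := by
  refine ⟨fun i j hij => Finset.disjoint_left.2 fun v hi hj => ?_, ?_⟩
  · obtain ⟨_, hi⟩ := mem_colorClasses.1 hi
    obtain ⟨_, hj⟩ := mem_colorClasses.1 hj
    exact hij (Fin.rev_injective (hi.symm.trans hj))
  · ext v
    simp only [Finset.mem_biUnion, Finset.mem_univ, true_and, mem_colorClasses]
    exact ⟨fun ⟨_, h, _⟩ => h, fun h => ⟨(c ⟨v, h⟩).rev, h, (Fin.rev_rev _).symm⟩⟩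

theorem bijective_colorClasses (I : Finset V) (n : ℕ) :
    Function.Bijective (fun c : I → Fin n =>
      (⟨colorClasses c, mem_decompositions.2 (isDecomposition_colorClasses c)⟩ :
        {S : Fin n → Finset V // S ∈ decompositions I n})) := by
  constructor
  · intro c c' h
    have hclasses : colorClasses c = colorClasses c' := congrArg Subtype.val h
    funext v
    have hv : (v : V) ∈ colorClasses c (c v).rev := mem_colorClasses.2 ⟨v.2, (Fin.rev_rev _).symm⟩
    rw [hclasses] at hv
    obtain ⟨_, hv⟩ := mem_colorClasses.1 hv
    exact (hv.trans (Fin.rev_rev _)).symm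
  · rintro ⟨S, hS⟩
    obtain ⟨hdisjoint, hunion⟩ := mem_decompositions.1 hS
    have hblock (v : I) : ∃ i, (v : V) ∈ S i := by
      have hv : (v : V) ∈ Finset.univ.biUnion S := by rw [hunion]; exact v.2
      simpa using hv
    choose f hf using hblock
    refine ⟨fun v => (f v).rev, Subtype.ext (funext fun i => Finset.ext fun v => ?_)⟩
    simp only [mem_colorClasses]
    constructor
    · rintro ⟨h, hv⟩
      rw [← Fin.rev_injective hv]
      exact hf ⟨v, h⟩
    · intro hv
      refine ⟨hunion ▸ Finset.mem_biUnion.2 ⟨i, Finset.mem_univ i, hv⟩, congrArg Fin.rev ?_⟩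
      by_contra hne
      exact Finset.disjoint_left.1 (hdisjoint _ _ hne) (hf ⟨v, _⟩) hv

end Colorings

section BasicInvariant

variable (𝕜 : Type*) [Field 𝕜] {V : Type*} [DecidableEq V] {I : Finset V} {n : ℕ}

theorem zetaTensor_consTensor (S : Fin (n + 1) → Finset V) (x : F 𝕜 (S 0))
    (y : ⨂[𝕜] i : Fin n, F 𝕜 (S i.succ)) :
    zetaTensor 𝕜 S (consTensor 𝕜 (fun i => F 𝕜 (S i)) (x ⊗ₜ y)) =
      zeta 𝕜 (S 0) x * zetaTensor 𝕜 (fun i => S i.succ) y := by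
  induction y using PiTensorProduct.induction_on with
  | smul_tprod r f => simp [zetaTensor, consTensor, Fin.prod_univ_succ, mul_left_comm]
  | add a b ha hb => rw [TensorProduct.tmul_add, map_add, map_add, map_add, ha, hb, mul_add]

theorem zetaTensor_isEmptyEquiv_symm (S : Fin 0 → Finset V) (x : 𝕜) :
    zetaTensor 𝕜 S ((PiTensorProduct.isEmptyEquiv (Fin 0)).symm x) = x := by
  simp [zetaTensor]

open Classical in
theorem zetaTensor_iteratedCoproduct_single {R : V → V → Prop} [IsTrans V R]
    {S : Fin n → Finset V} (hS : IsDecomposition S I)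
    (hR : ∀ i j, ∀ u ∈ S i, ∀ v ∈ S j, (R u v ↔ j < i)) (α : SetOfPaths I) :
    zetaTensor 𝕜 S (iteratedCoproduct 𝕜 S hS (Finsupp.single α 1)) =
      if ∀ s, UWord.mk s ∈ α.paths → HasHeap R s then 1 else 0 := by
  induction n generalizing I with
  | zero =>
    have hI : I = ∅ := by rw [← hS.2, Finset.univ_eq_empty, Finset.biUnion_empty]
    rw [if_pos]
    · simp only [iteratedCoproduct, LinearMap.comp_apply, LinearEquiv.coe_coe,
        zetaTensor_isEmptyEquiv_symm, counit, Finsupp.linearCombination_single, smul_eq_mul,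
        mul_one]
    · intro s hs
      obtain rfl : s = [] := List.eq_nil_iff_forall_not_mem.2 fun v hv => by
        simpa [hI] using SetOfPaths.mem_of_mem_of_mk_mem hs hv
      exact hasHeap_nil
  | succ n ih =>
    have hblock {s : List V} (hs : UWord.mk s ∈ α.paths) {v : V} (hv : v ∈ s) :
        ∃ i, v ∈ S i := by
      simpa [← hS.2] using SetOfPaths.mem_of_mem_of_mk_mem hs hv
    simp only [iteratedCoproduct, LinearMap.comp_apply]
    rw [coproduct, Finsupp.linearCombination_single, one_smul, TensorProduct.map_tmul,
      LinearMap.id_apply, zetaTensor_consTensor,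
      ih hS.tail (fun i j u hu v hv => by rw [hR _ _ u hu v hv, Fin.succ_lt_succ_iff]),
      zeta, Finsupp.linearCombination_single, one_smul, ite_zero_mul_ite_zero, mul_one]
    refine if_congr ?_ rfl rfl
    rw [SetOfPaths.isDiscrete_restrict_iff,
      SetOfPaths.forall_mk_mem_contract_paths_iff _ _ _ _ _ hasHeap_nil, ← forall_and]
    refine forall_congr' fun s => ?_
    rw [← imp_and]
    refine imp_congr_right fun hs => (hasHeap_iff_splitOnP (fun v _ hv0 u hu => ?_)
      (fun u hu hu0 v _ hv0 => ?_)).symm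
    · obtain ⟨i, hi⟩ := hblock hs hu
      rw [hR 0 i v (of_decide_eq_true hv0) u hi]
      exact Fin.not_lt_zero i
    · obtain ⟨i, hi⟩ := hblock hs hu
      rw [hR i 0 u hi v (of_decide_eq_true hv0), Fin.pos_iff_ne_zero]
      rintro rfl
      exact hu0 (decide_eq_true hi)

theorem chi_single (α : SetOfPaths I) (n : ℕ) :
    chi 𝕜 (Finsupp.single α 1) n =
      (Nat.card {c : I → Fin n // ∀ s, UWord.mk s ∈ α.paths → HasHeap (ColorLT c) s} : 𝕜) := by
  classical
  rw [chi, ← (bijective_colorClasses I n).sum_comp, Nat.card_eq_fintype_card,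
    Fintype.card_subtype, ← Finset.sum_boole]
  refine Finset.sum_congr rfl fun c _ => zetaTensor_iteratedCoproduct_single 𝕜 _ ?_ α
  intro i j u hu v hv
  obtain ⟨hu, hcu⟩ := mem_colorClasses.1 hu
  obtain ⟨hv, hcv⟩ := mem_colorClasses.1 hv
  rw [colorLT_coe (u := ⟨u, hu⟩) (v := ⟨v, hv⟩), hcu, hcv, Fin.rev_lt_rev]

end BasicInvariant

/-! ### Compatible pairs as colored trees -/

section Pairs

variable {A B C : Type*}

theorem card_isLabelling_pairs (w : List A) (Q : C → BinaryTree A → Prop) :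
    Nat.card {p : BinaryTree Unit × C // p.1.numNodes = w.length ∧
        ∃ s, IsLabelling w p.1 s ∧ Q p.2 s} =
      Nat.card {q : C × BinaryTree A // inorder q.2 = w ∧ Q q.1 q.2} := by
  symm
  refine Nat.card_eq_of_bijective (fun q => ⟨(q.1.2.map fun _ => (), q.1.1),
    by rw [numNodes_map, ← length_inorder, q.2.1], q.1.2, ⟨rfl, q.2.1⟩, q.2.2⟩) ⟨?_, ?_⟩
  · rintro ⟨⟨c, s⟩, hs, _⟩ ⟨⟨c', s'⟩, hs', _⟩ h
    obtain ⟨hshape, rfl⟩ := Prod.mk.inj (congrArg Subtype.val h)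
    obtain rfl := eq_of_map_const_eq_of_inorder_eq hshape (hs.trans hs'.symm)
    rfl
  · rintro ⟨⟨t, c⟩, _, s, ⟨hshape, hs⟩, hQ⟩
    exact ⟨⟨(c, s), hs, hQ⟩, Subtype.ext (Prod.ext hshape rfl)⟩

theorem exists_map_eq_of_length_eq {w : List A} (hnodup : w.Nodup) (hmem : ∀ a, a ∈ w)
    {l : List B} (hlength : l.length = w.length) : ∃ c : A → B, w.map c = l := by
  classical
  refine ⟨fun a => l[w.idxOf a]'(hlength ▸ List.idxOf_lt_length_of_mem (hmem a)), ?_⟩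
  exact List.ext_getElem (by simp [hlength]) fun i _ _ => by simp [hnodup.idxOf_getElem]

theorem card_isHeap_colorings {w : List A} (hnodup : w.Nodup) (hmem : ∀ a, a ∈ w)
    (R : B → B → Prop) :
    Nat.card {q : (A → B) × BinaryTree A //
        inorder q.2 = w ∧ IsHeap (fun u v => R (q.1 u) (q.1 v)) q.2} =
      Nat.card {t : BinaryTree B // t.numNodes = w.length ∧ IsHeap R t} := by
  refine Nat.card_eq_of_bijective (fun q => ⟨q.1.2.map q.1.1,
    by rw [numNodes_map, ← length_inorder, q.2.1], isHeap_map.2 q.2.2⟩) ⟨?_, ?_⟩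
  · rintro ⟨⟨c, s⟩, hs, _⟩ ⟨⟨c', s'⟩, hs', _⟩ h
    have htree : s.map c = s'.map c' := congrArg Subtype.val h
    have hshape : s.map (fun _ => ()) = s'.map (fun _ => ()) := by
      simpa only [← BinaryTree.comp_map] using congrArg (BinaryTree.map fun _ => ()) htree
    obtain rfl := eq_of_map_const_eq_of_inorder_eq hshape (hs.trans hs'.symm)
    have hword : w.map c = w.map c' := by
      simpa only [inorder_map, hs] using congrArg inorder htree
    obtain rfl : c = c' := funext fun a => List.map_inj_left.1 hword a (hmem a)
    rfl
  · rintro ⟨t, hsize, ht⟩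
    obtain ⟨c, hc⟩ :=
      exists_map_eq_of_length_eq hnodup hmem ((length_inorder t).trans hsize)
    obtain ⟨s, rfl, hs⟩ := exists_map_eq_of_inorder_eq_map hc.symm
    exact ⟨⟨(c, s), hs, isHeap_map.1 ht⟩, rfl⟩

theorem card_isHeap_colorings_eq_card_hasHeap (w : List A) (R : B → B → Prop) [IsTrans B R]
    [Std.Asymm R] :
    Nat.card {q : (A → B) × BinaryTree A //
        inorder q.2 = w ∧ IsHeap (fun u v => R (q.1 u) (q.1 v)) q.2} =
      Nat.card {c : A → B // HasHeap (fun u v => R (c u) (c v)) w} := by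
  refine Nat.card_eq_of_bijective (fun q => ⟨q.1.1, q.1.2, q.2⟩) ⟨?_, ?_⟩
  · rintro ⟨⟨c, s⟩, hs, hheap⟩ ⟨⟨c', s'⟩, hs', hheap'⟩ h
    obtain rfl : c = c' := congrArg Subtype.val h
    have : IsTrans A fun u v => R (c u) (c v) := ⟨fun _ _ _ => trans_of R⟩
    have : Std.Asymm fun u v => R (c u) (c v) := ⟨fun _ _ => asymm_of R⟩
    obtain rfl := hheap.eq_of_inorder_eq hheap' (hs.trans hs'.symm)
    rfl
  · rintro ⟨c, s, hs⟩
    exact ⟨⟨(c, s), hs⟩, rfl⟩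

theorem card_isHeap_fin {b : ℕ → ℕ} (hb : ∀ k, b k ≤ k + 1) (m n : ℕ) :
    Nat.card {t : BinaryTree (Fin n) //
        t.numNodes = m ∧ IsHeap (fun u v : Fin n => (u : ℕ) < b v) t} =
      (coloredTrees b m n).card := by
  rw [← Nat.card_eq_finsetCard]
  refine Nat.card_eq_of_bijective (fun t => ⟨t.1.map Fin.val, mem_coloredTrees.2
    ⟨(numNodes_map _ _).trans t.2.1, ?_, isHeap_map.2 t.2.2⟩⟩) ⟨?_, ?_⟩
  · simp only [root?_map, Option.map_eq_some_iff]
    rintro _ ⟨u, -, rfl⟩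
    exact u.2
  · exact fun t t' h => Subtype.ext (map_injective Fin.val_injective (congrArg Subtype.val h))
  · rintro ⟨t, ht⟩
    obtain ⟨hsize, hroot, hheap⟩ := mem_coloredTrees.1 ht
    have hlt : ∀ u ∈ inorder t, u < n :=
      hheap.forall_mem_inorder (fun u v huv hv => by have := hb v; lia) hroot
    lift inorder t to List (Fin n) using hlt with l hl
    obtain ⟨s, rfl, -⟩ := exists_map_eq_of_inorder_eq_map hl.symm
    exact ⟨⟨s, (numNodes_map _ _).symm.trans hsize, isHeap_map.1 hheap⟩, rfl⟩

end Pairs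

section Compatible

variable {V : Type*} {I : Finset V}

theorem exists_isLabelling_coe_iff {w : List I} {t : BinaryTree Unit} {R : I → I → Prop} :
    (∃ t', IsLabelling (w.map (↑)) t t' ∧ ∀ u v : I, IsChild t' (u : V) (v : V) → R u v) ↔
      ∃ s, IsLabelling w t s ∧ IsHeap R s := by
  simp only [exists_isLabelling_map_iff, isChild_map, IsHeap,
    Relation.map_apply_apply Subtype.val_injective Subtype.val_injective]

theorem hasHeap_colorLT_map_coe {n : ℕ} {c : I → Fin n} {w : List I} :
    HasHeap (ColorLT c) (w.map (↑)) ↔ HasHeap (fun u v => c u < c v) w := by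
  simp only [hasHeap_map, colorLT_coe]

variable [DecidableEq V]

theorem exists_list_coe_eq {w : List V} (hnodup : w.Nodup) (hI : w.toFinset = I) :
    ∃ w' : List I, w'.map (↑) = w ∧ w'.Nodup ∧ (∀ v, v ∈ w') ∧ w'.length = I.card := by
  subst hI
  refine ⟨w.attachWith _ fun v hv => List.mem_toFinset.2 hv, by simp, ?_, ?_, ?_⟩
  · exact List.Nodup.of_map Subtype.val (by simpa using hnodup)
  · simp
  · rw [List.length_attachWith, List.toFinset_card_of_nodup hnodup]

theorem numStrictlyCompatible_eq_card_coloredTrees {w : List V} (hnodup : w.Nodup)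
    (hI : w.toFinset = I) (n : ℕ) :
    numStrictlyCompatible I w n = (coloredTrees id I.card n).card := by
  obtain ⟨w, rfl, hnodup, hmem, hcard⟩ := exists_list_coe_eq hnodup hI
  simp only [numStrictlyCompatible, StrictlyCompatible, exists_isLabelling_coe_iff, ← hcard,
    card_isLabelling_pairs w fun (c : I → Fin n) => IsHeap fun u v => c u < c v,
    card_isHeap_colorings hnodup hmem (· < ·)]
  exact card_isHeap_fin (fun k => k.le_succ) w.length n

theorem numCompatible_eq_card_coloredTrees {w : List V} (hnodup : w.Nodup)
    (hI : w.toFinset = I) (n : ℕ) :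
    numCompatible I w n = (coloredTrees Nat.succ I.card n).card := by
  obtain ⟨w, rfl, hnodup, hmem, hcard⟩ := exists_list_coe_eq hnodup hI
  simp only [numCompatible, Compatible, exists_isLabelling_coe_iff, ← hcard,
    card_isLabelling_pairs w fun (c : I → Fin n) => IsHeap fun u v => c u ≤ c v,
    card_isHeap_colorings hnodup hmem (· ≤ ·)]
  simpa only [Nat.lt_succ_iff, Fin.val_fin_le] using
    card_isHeap_fin (b := Nat.succ) (fun _ => le_rfl) w.length n

theorem chi_single_eq_numStrictlyCompatible (𝕜 : Type*) [Field 𝕜] {α : SetOfPaths I} {w : List V}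
    (hα : α.IsPathWithWord w) (n : ℕ) :
    chi 𝕜 (Finsupp.single α 1) n = (numStrictlyCompatible I w n : 𝕜) := by
  rw [chi_single]
  simp only [hα.forall_mk_mem_paths_hasHeap_iff]
  obtain ⟨hnodup, hI, -⟩ := hα
  obtain ⟨w, rfl, -, -, hcard⟩ := exists_list_coe_eq hnodup hI
  simp only [numStrictlyCompatible, StrictlyCompatible, exists_isLabelling_coe_iff, ← hcard,
    card_isLabelling_pairs w fun (c : I → Fin n) => IsHeap fun u v => c u < c v,
    card_isHeap_colorings_eq_card_hasHeap w (B := Fin n) (· < ·), hasHeap_colorLT_map_coe]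

end Compatible

end PathMonoid

theorem mainTheorem5 (𝕜 : Type*) [Field 𝕜] {V : Type*} [DecidableEq V] (I : Finset V)
    (α : PathMonoid.SetOfPaths I) (w : List V) (hα : α.IsPathWithWord w) :
    (∀ n : ℕ, PathMonoid.chi 𝕜 (Finsupp.single α 1) n =
      (PathMonoid.numStrictlyCompatible I w n : 𝕜)) ∧
    (CharZero 𝕜 →
      (∃! P : Polynomial 𝕜, PathMonoid.IsBasicInvariantPolynomial (Finsupp.single α 1) P) ∧
      ∀ P : Polynomial 𝕜, PathMonoid.IsBasicInvariantPolynomial (Finsupp.single α 1) P →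
        (∀ n : ℕ, (-1) ^ I.card * P.eval (-(n : 𝕜)) = (PathMonoid.numCompatible I w n : 𝕜)) ∧
        (-1) ^ I.card * P.eval (-1) = (catalan I.card : 𝕜)) := by
  have hchi := PathMonoid.chi_single_eq_numStrictlyCompatible 𝕜 hα
  refine ⟨hchi, fun _ => ?_⟩
  obtain ⟨hnodup, hI, -⟩ := hα
  set P : Polynomial 𝕜 := PathMonoid.treePolynomial 𝕜 I.card
  have hP : PathMonoid.IsBasicInvariantPolynomial (Finsupp.single α 1) P := fun n => by
    rw [hchi, PathMonoid.numStrictlyCompatible_eq_card_coloredTrees hnodup hI,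
      PathMonoid.eval_natCast_treePolynomial]
  have hunique (Q : Polynomial 𝕜)
      (hQ : PathMonoid.IsBasicInvariantPolynomial (Finsupp.single α 1) Q) : Q = P :=
    PathMonoid.polynomial_eq_of_eval_natCast_eq fun n => (hQ n).trans (hP n).symm
  have hreciprocity := PathMonoid.neg_one_pow_mul_eval_neg_natCast_treePolynomial (R := 𝕜) I.card
  refine ⟨⟨P, hP, hunique⟩, fun Q hQ => ?_⟩
  obtain rfl := hunique Q hQ
  refine ⟨fun n => ?_, ?_⟩
  · rw [hreciprocity, PathMonoid.numCompatible_eq_card_coloredTrees hnodup hI]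
  · rw [← PathMonoid.card_coloredTrees_succ_one, ← hreciprocity, Nat.cast_one]
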